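/- Let $N\ge 1$ be an integer. For $a=(a_1,\dots,a_N)\in\mathbb R^N$ put $$C_a(t)=\sum_{j=1}^N a_j\cos(2j-1)t,\qquad S_a(t)=\sum_{j=1}^N a_j\sin(2j-1)t,$$ and let $T_a$ be the set of points of $(0,\pi/2)$ at which $C_a$ changes sign, that is, the points $t$ such that, near $t$, the values of $C_a$ on the left and on the right of $t$ are nonzero and of opposite signs. Then for every $a$ with $\sum_{j=1}^N a_j=1$ the maximum $$M(a)=\max\{S_a(t): t\in T_a\cup\{\pi/2\}\}$$ exists, and $$\min_{a_1+\dots+a_N=1} M(a)=\frac1N .$$ The minimum is attained at exactly one vector $a$, namely at $a^0$ with $$a_j^0=\frac{2(N-j)+1}{N^2},\qquad j=1,\dots,N.$$ The corresponding optimal polynomial $C^0=C_{a^0}$ satisfies $$C^0(t)=\left(\frac{\sin Nt}{N\sin t}\right)^2\cos t\quad(\sin t\ne 0),$$ and, for all real $t$, $$C^0(t)=\cos t\left(\frac1N+2\sum_{j=2}^N\frac{N-j+1}{N^2}\cos 2(j-1)t\right).$$ -/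

import Mathlib

namespace CycleStab

noncomputable section

/-- Cosine polynomial `C(t) = ∑_{j=1}^N a_j cos((2j-1)t)`; the index `j : Fin N` stands for the
coefficient number `j + 1`. -/
def cosPoly {N : ℕ} (a : Fin N → ℝ) (t : ℝ) : ℝ :=
  ∑ j : Fin N, a j * Real.cos ((2 * ((j : ℝ) + 1) - 1) * t)

/-- Conjugate sine polynomial `S(t) = ∑_{j=1}^N a_j sin((2j-1)t)`. -/
def sinPoly {N : ℕ} (a : Fin N → ℝ) (t : ℝ) : ℝ :=
  ∑ j : Fin N, a j * Real.sin ((2 * ((j : ℝ) + 1) - 1) * t)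

/-- `f` changes sign at `t`: close to `t`, the values of `f` on the left and on the right of `t`
are nonzero and of opposite signs. -/
def IsSignChange (f : ℝ → ℝ) (t : ℝ) : Prop :=
  ∃ ε > 0, ∀ x ∈ Set.Ioo (t - ε) t, ∀ y ∈ Set.Ioo t (t + ε), f x * f y < 0

/-- The set `T` of sign changes of `C` on the open interval `(0, π/2)`. -/
def signChanges {N : ℕ} (a : Fin N → ℝ) : Set ℝ :=
  {t | t ∈ Set.Ioo 0 (Real.pi / 2) ∧ IsSignChange (cosPoly a) t}

/-- The set of values `{S(t) : t ∈ T ∪ {π/2}}`. -/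
def testValues {N : ℕ} (a : Fin N → ℝ) : Set ℝ :=
  sinPoly a '' (signChanges a ∪ {Real.pi / 2})

/-- The objective `max {S(t) : t ∈ T ∪ {π/2}}`, written as a supremum. -/
def objective {N : ℕ} (a : Fin N → ℝ) : ℝ :=
  sSup (testValues a)

/-- Coefficient vectors normalized by `∑ a_j = 1`. -/
def normalized (N : ℕ) : Set (Fin N → ℝ) :=
  {a | ∑ j, a j = 1}

/-- The coefficients `a_j^0 = (2(N-j)+1)/N²`, `j = 1, …, N`. -/
def optCoeff (N : ℕ) (j : Fin N) : ℝ :=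
  (2 * ((N : ℝ) - ((j : ℝ) + 1)) + 1) / (N : ℝ) ^ 2

end

end CycleStab

namespace CycleStab

open Polynomial Finset

/-! Put `Q = cosFactor a`, so that `C_a(t) = cos t * Q(cos 2t)` with `deg Q < N` and `Q(1) = 1`. The
mean over the nodes `cos (2πj/N)` kills `T_k` for `0 < k < N`. Hence, if `y = cos 2t` is a root of
`(X + 1) Q`, then `S_a(t)` is `sin t` times the node mean of `(X + 1) Q / (X - y)` (`sinPoly_eq`).
The root `y = -1` is the point `t = π/2`, where `S_a(π/2)` is the mean of `Q` itself.

If `Q ≥ 0` on `[-1, 1]`, keeping only the node `1` gives `S_a(π/2) ≥ Q(1)/N = 1/N`. Otherwise the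
bound `S_a ≤ 1/N` at every test point is contradictory (`cosFactor_nonneg`): a nonnegative
combination of the quotients at `-1` and at the sign changes is again nonnegative on `[-1, 1]`
(`exists_nonneg_combination`), yet its node mean would fall below `1/N` times its value at `1`.

Equality forces `Q` to vanish at all nodes except `1`, doubly at interior ones. With the value at
`1` these are `N` conditions in degree less than `N`, whence uniqueness. The Fejér-type vector `a^0`
has no sign changes and attains `1/N`. -/

/-! ### Algebraic form of the cosine polynomial -/

/-- The Chebyshev polynomial of the third kind, `V n (cos 2t) * cos t = cos ((2n+1)t)`. -/
noncomputable def chebV (n : ℕ) : ℝ[X] := Chebyshev.U ℝ n - Chebyshev.U ℝ (n - 1)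

lemma degree_chebV (n : ℕ) : (chebV n).degree = n := by
  have h := Chebyshev.degree_U_natCast ℝ n
  cases n with
  | zero => simp [chebV]
  | succ n =>
    have h' := Chebyshev.degree_U_natCast ℝ n
    rw [chebV, show (((n + 1 : ℕ) : ℤ) - 1) = (n : ℤ) by push_cast; ring,
      degree_sub_eq_left_of_degree_lt, h]
    rw [h, h']
    exact_mod_cast Nat.lt_succ_self n

lemma X_add_one_mul_chebV (n : ℕ) :
    (X + 1) * chebV n = Chebyshev.T ℝ ((n + 1 : ℕ) : ℤ) + Chebyshev.T ℝ (n : ℤ) := by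
  have h1 := Chebyshev.T_eq_U_sub_X_mul_U ℝ ((n : ℤ) + 1)
  have h2 := Chebyshev.T_eq_U_sub_X_mul_U ℝ (n : ℤ)
  have h3 := Chebyshev.U_add_one ℝ (n : ℤ)
  rw [add_sub_cancel_right] at h1
  rw [chebV, Nat.cast_add, Nat.cast_one, h1, h2, h3]
  ring

lemma chebV_eval_one (n : ℕ) : (chebV n).eval 1 = 1 := by
  simp [chebV]

lemma chebV_eval_cos (n : ℕ) {t : ℝ} (ht : Real.cos t ≠ 0) :
    Real.cos t * (chebV n).eval (Real.cos (2 * t)) = Real.cos ((2 * ((n : ℝ) + 1) - 1) * t) := by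
  have h := congrArg (eval (Real.cos (2 * t))) (X_add_one_mul_chebV n)
  rw [eval_mul, eval_add, eval_add, Chebyshev.T_real_cos, Chebyshev.T_real_cos] at h
  simp only [eval_X, eval_one] at h
  have e1 : ((((n + 1 : ℕ) : ℤ) : ℝ)) * (2 * t) = (2 * ((n : ℝ) + 1) - 1) * t + t := by
    push_cast; ring
  have e2 : (((n : ℤ) : ℝ)) * (2 * t) = (2 * ((n : ℝ) + 1) - 1) * t - t := by
    push_cast; ring
  rw [e1, e2, Real.cos_add, Real.cos_sub, Real.cos_two_mul] at h
  have : (2 * Real.cos t) * (Real.cos t * (chebV n).eval (2 * Real.cos t ^ 2 - 1)) =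
      (2 * Real.cos t) * Real.cos ((2 * ((n : ℝ) + 1) - 1) * t) := by linear_combination h
  rw [Real.cos_two_mul]
  exact mul_left_cancel₀ (by simpa using ht) this

/-- The algebraic polynomial `Q` with `cosPoly a t = cos t * Q (cos 2t)`. -/
noncomputable def cosFactor {N : ℕ} (a : Fin N → ℝ) : ℝ[X] := ∑ j : Fin N, C (a j) * chebV j

lemma cosPoly_eq {N : ℕ} (a : Fin N → ℝ) {t : ℝ} (ht : Real.cos t ≠ 0) :
    cosPoly a t = Real.cos t * (cosFactor a).eval (Real.cos (2 * t)) := by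
  rw [cosPoly, cosFactor, eval_finsetSum, mul_sum]
  refine sum_congr rfl fun j _ => ?_
  rw [← chebV_eval_cos _ ht, eval_mul, eval_C]
  ring

lemma cosFactor_eval_one {N : ℕ} (a : Fin N → ℝ) : (cosFactor a).eval 1 = ∑ j, a j := by
  simp [cosFactor, eval_finsetSum, chebV_eval_one]

lemma degree_cosFactor_lt {N : ℕ} (a : Fin N → ℝ) : (cosFactor a).degree < N := by
  rw [← mem_degreeLT]
  refine Submodule.sum_mem _ fun j _ => ?_
  rw [← smul_eq_C_mul]
  refine Submodule.smul_mem _ _ ?_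
  rw [mem_degreeLT, degree_chebV]
  exact_mod_cast j.2

/-- The `chebV n` have pairwise distinct degrees, hence are independent. This carries uniqueness of
the polynomial back to the coefficients. -/
lemma cosFactor_injective {N : ℕ} : Function.Injective (cosFactor (N := N)) := by
  let s : Polynomial.Sequence ℝ := ⟨chebV, degree_chebV⟩
  have h := (s.linearIndependent).comp (fun j : Fin N => (j : ℕ)) Fin.val_injective
  intro a b hab
  have h' := Fintype.linearIndependent_iff.1 h (fun j => a j - b j) ?_
  · funext j
    exact sub_eq_zero.1 (h' j)
  · simp only [sub_smul, sum_sub_distrib, smul_eq_C_mul, sub_eq_zero]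
    exact hab

/-! ### Quadrature at the nodes -/

/-- The quadrature nodes `cos (2πj/N)`. -/
noncomputable def node (N j : ℕ) : ℝ := Real.cos (2 * Real.pi * j / N)

/-- The mean of the values of a polynomial at the nodes `cos (2πj/N)`, `0 ≤ j < N`. -/
noncomputable def nodeMean (N : ℕ) : ℝ[X] →ₗ[ℝ] ℝ :=
  (1 / (N : ℝ)) • ∑ j ∈ range N, leval (node N j)

lemma nodeMean_apply (N : ℕ) (P : ℝ[X]) :
    nodeMean N P = 1 / (N : ℝ) * ∑ j ∈ range N, P.eval (node N j) := by
  simp [nodeMean, LinearMap.sum_apply]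

lemma node_zero (N : ℕ) : node N 0 = 1 := by simp [node]

lemma node_mem (N j : ℕ) : node N j ∈ Set.Icc (-1 : ℝ) 1 :=
  ⟨Real.neg_one_le_cos _, Real.cos_le_one _⟩

lemma nodeMean_one {N : ℕ} (hN : 1 ≤ N) : nodeMean N 1 = 1 := by
  have : (N : ℝ) ≠ 0 := by positivity
  rw [nodeMean_apply]
  simp [this]

/-- The sum is the real part of a full geometric sum of the `N`-th root of unity `z ^ k ≠ 1`. -/
lemma nodeMean_T {N k : ℕ} (hk : 0 < k) (hkN : k < N) :
    nodeMean N (Chebyshev.T ℝ (k : ℤ)) = 0 := by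
  have hN : N ≠ 0 := by omega
  have hN' : (N : ℂ) ≠ 0 := by exact_mod_cast hN
  have hz := Complex.isPrimitiveRoot_exp N hN
  set z := Complex.exp (2 * Real.pi * Complex.I / N) with hzdef
  have hne : z ^ k ≠ 1 := hz.pow_ne_one_of_pos_of_lt hk.ne' hkN
  have hgeom : ∑ j ∈ range N, (z ^ k) ^ j = 0 := by
    rw [geom_sum_eq hne, ← pow_mul, mul_comm k, pow_mul, hz.pow_eq_one, one_pow, sub_self, zero_div]
  have hre := congrArg Complex.re hgeom
  rw [Complex.re_sum, Complex.zero_re] at hre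
  rw [nodeMean_apply]
  have : ∑ j ∈ range N, (Chebyshev.T ℝ (k : ℤ)).eval (node N j) = 0 := by
    rw [← hre]
    refine sum_congr rfl fun j _ => ?_
    rw [node, Chebyshev.T_real_cos, hzdef, ← Complex.exp_nat_mul, ← Complex.exp_nat_mul,
      ← Complex.exp_ofReal_mul_I_re]
    congr 2
    push_cast
    field_simp
  rw [this, mul_zero]

/-! ### Divided differences and the conjugate sine polynomial -/

/-- The divided difference of `P` at `y`. -/
noncomputable def divDiff (y : ℝ) (P : ℝ[X]) : ℝ[X] := (P - C (P.eval y)) /ₘ (X - C y)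

lemma X_sub_C_mul_divDiff (y : ℝ) (P : ℝ[X]) : (X - C y) * divDiff y P = P - C (P.eval y) := by
  rw [divDiff, mul_divByMonic_eq_iff_isRoot]
  simp

lemma divDiff_eq {y : ℝ} {P H : ℝ[X]} (h : (X - C y) * H = P - C (P.eval y)) : divDiff y P = H :=
  mul_left_cancel₀ (X_sub_C_ne_zero y) ((X_sub_C_mul_divDiff y P).trans h.symm)

lemma divDiff_T_add_two (y : ℝ) (n : ℕ) :
    divDiff y (Chebyshev.T ℝ ((n + 2 : ℕ) : ℤ)) =
      2 * Chebyshev.T ℝ ((n + 1 : ℕ) : ℤ) + C (2 * y) * divDiff y (Chebyshev.T ℝ ((n + 1 : ℕ) : ℤ))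
        - divDiff y (Chebyshev.T ℝ (n : ℤ)) := by
  have h1 := X_sub_C_mul_divDiff y (Chebyshev.T ℝ ((n + 1 : ℕ) : ℤ))
  have h2 := X_sub_C_mul_divDiff y (Chebyshev.T ℝ (n : ℤ))
  have h := Chebyshev.T_add_two ℝ (n : ℤ)
  apply divDiff_eq
  push_cast at *
  have he : C ((Chebyshev.T ℝ ((n : ℤ) + 2)).eval y) =
      2 * C y * C ((Chebyshev.T ℝ ((n : ℤ) + 1)).eval y) - C ((Chebyshev.T ℝ (n : ℤ)).eval y) := by
    rw [h]
    simp only [eval_sub, eval_mul, eval_X, eval_ofNat, C_sub, C_mul]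
    rfl
  rw [he, h, C_mul, show (C (2 : ℝ) : ℝ[X]) = 2 from rfl]
  linear_combination (2 * C y) * h1 - h2

/-- Since the mean kills `T_{n+1}`, the means `e n` of the divided differences of `T_n` obey the
Chebyshev recurrence with `e 0 = 0`, `e 1 = 1`: they are `U_{n-1}(cos 2t)`. The sines on the right
satisfy the same recurrence. -/
lemma sin_mul_nodeMean_divDiff {N : ℕ} (hN : 1 ≤ N) (t : ℝ) (n : ℕ) (hn : n + 1 ≤ N) :
    Real.sin t * nodeMean N (divDiff (Real.cos (2 * t)) ((X + 1) * chebV n)) =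
      Real.sin ((2 * ((n : ℝ) + 1) - 1) * t) := by
  set y := Real.cos (2 * t) with hy
  let e : ℕ → ℝ := fun n => nodeMean N (divDiff y (Chebyshev.T ℝ (n : ℤ)))
  have e0 : e 0 = 0 := by
    have : divDiff y (Chebyshev.T ℝ ((0 : ℕ) : ℤ)) = 0 := divDiff_eq (by simp)
    simp only [e, this, map_zero]
  have e1 : e 1 = 1 := by
    have : divDiff y (Chebyshev.T ℝ ((1 : ℕ) : ℤ)) = 1 := divDiff_eq (by simp)
    simp only [e, this, nodeMean_one hN]
  have hrec : ∀ n, n + 2 ≤ N → e (n + 2) = 2 * y * e (n + 1) - e n := by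
    intro n hn
    have h0 : nodeMean N (2 * Chebyshev.T ℝ ((n + 1 : ℕ) : ℤ)) = 0 := by
      rw [two_mul, map_add, nodeMean_T (by omega) (by omega), add_zero]
    simp only [e]
    rw [divDiff_T_add_two, map_sub, map_add, h0, ← smul_eq_C_mul, map_smul, smul_eq_mul, zero_add]
  have hlin : divDiff y ((X + 1) * chebV n) =
      divDiff y (Chebyshev.T ℝ ((n + 1 : ℕ) : ℤ)) + divDiff y (Chebyshev.T ℝ (n : ℤ)) := by
    apply divDiff_eq
    rw [mul_add, X_sub_C_mul_divDiff, X_sub_C_mul_divDiff, X_add_one_mul_chebV, eval_add, C_add]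
    ring
  have main : ∀ n, n + 1 ≤ N → Real.sin t * (e (n + 1) + e n) =
      Real.sin ((2 * ((n : ℝ) + 1) - 1) * t) := by
    intro n
    induction n using Nat.strong_induction_on with
    | _ n ih =>
      intro hn
      match n, ih, hn with
      | 0, _, _ => simp [e0, e1]; norm_num
      | 1, _, hn =>
        rw [hrec 0 hn, e1, e0, hy, Real.cos_two_mul]
        push_cast
        rw [show (2 * ((1 : ℝ) + 1) - 1) * t = 3 * t by ring, Real.sin_three_mul]
        have := Real.sin_sq_add_cos_sq t
        linear_combination 4 * Real.sin t * this
      | n + 2, ih, hn =>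
        have i1 := ih (n + 1) (by omega) (by omega)
        have i0 := ih n (by omega) (by omega)
        have r1 := hrec (n + 1) (by omega)
        have r0 := hrec n (by omega)
        have key : Real.sin ((2 * (((n + 2 : ℕ) : ℝ) + 1) - 1) * t) =
            2 * y * Real.sin ((2 * (((n + 1 : ℕ) : ℝ) + 1) - 1) * t)
              - Real.sin ((2 * ((n : ℝ) + 1) - 1) * t) := by
          rw [show (2 * (((n + 2 : ℕ) : ℝ) + 1) - 1) * t =
              (2 * (((n + 1 : ℕ) : ℝ) + 1) - 1) * t + 2 * t by push_cast; ring,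
            show (2 * ((n : ℝ) + 1) - 1) * t =
              (2 * (((n + 1 : ℕ) : ℝ) + 1) - 1) * t - 2 * t by push_cast; ring,
            Real.sin_add, Real.sin_sub, hy]
          ring
        rw [key, ← i1, ← i0, r1, r0]
        ring
  rw [hlin, map_add]
  exact main n hn

lemma sinPoly_eq {N : ℕ} (hN : 1 ≤ N) (a : Fin N → ℝ) {t : ℝ} {H : ℝ[X]}
    (h : (X + 1) * cosFactor a = (X - C (Real.cos (2 * t))) * H) :
    sinPoly a t = Real.sin t * nodeMean N H := by
  have hroot : ((X + 1) * cosFactor a).eval (Real.cos (2 * t)) = 0 := by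
    rw [h]; simp
  have hH : H = ∑ j : Fin N, a j • divDiff (Real.cos (2 * t)) ((X + 1) * chebV j) := by
    apply mul_left_cancel₀ (X_sub_C_ne_zero (Real.cos (2 * t)))
    rw [← h, mul_sum]
    have h1 : ∀ j : Fin N, (X - C (Real.cos (2 * t))) *
        (a j • divDiff (Real.cos (2 * t)) ((X + 1) * chebV j)) =
        (X + 1) * (C (a j) * chebV j) -
          C (((X + 1) * (C (a j) * chebV j)).eval (Real.cos (2 * t))) := by
      intro j
      rw [mul_smul_comm, X_sub_C_mul_divDiff, smul_eq_C_mul]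
      simp only [eval_mul, eval_C, C_mul]
      ring
    rw [sum_congr rfl fun j _ => h1 j, sum_sub_distrib, ← mul_sum, ← map_sum, ← eval_finsetSum,
      ← mul_sum]
    change _ = (X + 1) * cosFactor a - C (((X + 1) * cosFactor a).eval _)
    rw [hroot, C_0, sub_zero]
  rw [hH, map_sum, mul_sum, sinPoly]
  refine sum_congr rfl fun j _ => ?_
  rw [map_smul, smul_eq_mul, ← sin_mul_nodeMean_divDiff hN t j j.2]
  ring

/-! ### Factorization and positivity on `[-1, 1]` -/

/-- A real polynomial that is positive at `1` is, up to a factor that is nonnegative on `[-1, 1]`,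
the product of distinct linear factors vanishing in `(-1, 1)`. -/
lemma exists_simple_factor (Q : ℝ[X]) (hQ : 0 < Q.eval 1) :
    ∃ (Z : Finset ℝ) (R : ℝ[X]), (∀ y ∈ Z, y ∈ Set.Ioo (-1 : ℝ) 1) ∧
      Q = (∏ y ∈ Z, (X - C y)) * R ∧ ∀ x ∈ Set.Icc (-1 : ℝ) 1, 0 ≤ R.eval x := by
  induction hd : Q.natDegree generalizing Q with
  | zero =>
    refine ⟨∅, Q, by simp, by simp, fun x _ => ?_⟩
    rw [eq_C_of_natDegree_eq_zero hd, eval_C] at hQ ⊢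
    exact hQ.le
  | succ n ih =>
    by_cases hr : ∃ r ∈ Set.Ioo (-1 : ℝ) 1, Q.IsRoot r
    · obtain ⟨r, hr, hroot⟩ := hr
      obtain ⟨Q', rfl⟩ := dvd_iff_isRoot.2 hroot
      have hQ' : 0 < Q'.eval 1 := by
        rw [eval_mul, eval_sub, eval_X, eval_C] at hQ
        exact pos_of_mul_pos_right hQ (by linarith [hr.2])
      have hd' : Q'.natDegree = n := by
        rw [natDegree_mul (X_sub_C_ne_zero r) (by rintro rfl; simp at hQ'), natDegree_X_sub_C] at hd
        omega
      obtain ⟨Z, R, hZ, hfac, hR⟩ := ih Q' hQ' hd'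
      -- A repeated root leaves `Z` and contributes the square `(X - r)²` to `R`, so `Z` keeps
      -- exactly the roots of odd multiplicity.
      by_cases hrZ : r ∈ Z
      · refine ⟨Z.erase r, (X - C r) ^ 2 * R, fun y hy => hZ y (mem_of_mem_erase hy), ?_, ?_⟩
        · rw [hfac, ← mul_prod_erase Z _ hrZ]
          ring
        · intro x hx
          rw [eval_mul, eval_pow]
          exact mul_nonneg (sq_nonneg _) (hR x hx)
      · refine ⟨insert r Z, R, ?_, ?_, hR⟩
        · intro y hy
          rcases mem_insert.1 hy with rfl | hy
          · exact hr
          · exact hZ y hy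
        · rw [hfac, prod_insert hrZ, mul_assoc]
    · push Not at hr
      refine ⟨∅, Q, by simp, by simp, ?_⟩
      have hpos : ∀ x ∈ Set.Ioo (-1 : ℝ) 1, 0 ≤ Q.eval x := by
        intro x hx
        by_contra! hneg
        have hcont : ContinuousOn (fun x => Q.eval x) (Set.Icc x 1) := Q.continuous.continuousOn
        obtain ⟨r, hr1, hr2⟩ := intermediate_value_Ioo hx.2.le hcont ⟨hneg, hQ⟩
        exact hr r ⟨hx.1.trans hr1.1, hr1.2⟩ hr2
      have hcl : closure (Set.Ioo (-1 : ℝ) 1) = Set.Icc (-1) 1 := closure_Ioo (by norm_num)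
      intro x hx
      rw [← hcl] at hx
      exact closure_minimal hpos (isClosed_le continuous_const Q.continuous) hx

/-- A nonzero polynomial that is nonnegative on `[-1, 1]` is positive in a punctured neighbourhood
of each point of `(-1, 1)`. -/
lemma eventually_pos_of_nonneg {R : ℝ[X]} (hR0 : R ≠ 0)
    (hR : ∀ x ∈ Set.Icc (-1 : ℝ) 1, 0 ≤ R.eval x) {y : ℝ} (hy : y ∈ Set.Ioo (-1 : ℝ) 1) :
    ∀ᶠ x in nhdsWithin y {y}ᶜ, 0 < R.eval x := by
  have h1 : ∀ᶠ x in nhdsWithin y {y}ᶜ, x ∈ Set.Ioo (-1 : ℝ) 1 :=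
    nhdsWithin_le_nhds (isOpen_Ioo.mem_nhds hy)
  have h2 : ∀ᶠ x in nhdsWithin y {y}ᶜ, x ∉ (R.roots.toFinset.erase y : Finset ℝ) :=
    nhdsWithin_le_nhds ((Finset.isClosed _).isOpen_compl.mem_nhds (by simp))
  filter_upwards [h1, h2, self_mem_nhdsWithin] with x hx1 hx2 hx3
  refine lt_of_le_of_ne (hR x ⟨hx1.1.le, hx1.2.le⟩) fun h => hx2 ?_
  rw [mem_erase]
  exact ⟨hx3, by simpa [hR0] using h.symm⟩

/-- Products over a set of nodes with one factor omitted admit a combination with nonnegative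
weights that is nonnegative to the right of the smallest node. -/
lemma exists_nonneg_combination (Y : Finset ℝ) (hY : Y.Nonempty) :
    ∃ c : ℝ → ℝ, (∀ y ∈ Y, 0 ≤ c y) ∧ 0 < c (Y.max' hY) ∧
      ∀ x, (∃ y ∈ Y, y ≤ x) → 0 ≤ ∑ y ∈ Y, c y * ∏ z ∈ Y.erase y, (x - z) := by
  induction Y using Finset.strongInduction with
  | H Y ih =>
    obtain ⟨m, hm⟩ : ∃ m, m = Y.max' hY := ⟨_, rfl⟩
    rw [← hm]
    have hmY : m ∈ Y := hm ▸ Y.max'_mem hY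
    obtain ⟨Y₁, hmY₁, rfl⟩ : ∃ Y₁, m ∉ Y₁ ∧ Y = insert m Y₁ :=
      ⟨Y.erase m, notMem_erase _ _, (insert_erase hmY).symm⟩
    have hlt : ∀ y ∈ Y₁, y < m := fun y hy =>
      lt_of_le_of_ne (hm ▸ le_max' _ _ (mem_insert_of_mem hy)) (by rintro rfl; exact hmY₁ hy)
    rcases Y₁.eq_empty_or_nonempty with rfl | h₁
    · exact ⟨fun _ => 1, by simp, by simp, by simp⟩
    obtain ⟨l, hl⟩ : ∃ l, l = Y₁.max' h₁ := ⟨_, rfl⟩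
    have hlY : l ∈ Y₁ := hl ▸ Y₁.max'_mem h₁
    have hlm : l < m := hlt l hlY
    obtain ⟨Y₂, hlY₂, rfl⟩ : ∃ Y₂, l ∉ Y₂ ∧ Y₁ = insert l Y₂ :=
      ⟨Y₁.erase l, notMem_erase _ _, (insert_erase hlY).symm⟩
    have hlt₂ : ∀ y ∈ Y₂, y < l := fun y hy =>
      lt_of_le_of_ne (hl ▸ le_max' _ _ (mem_insert_of_mem hy)) (by rintro rfl; exact hlY₂ hy)
    have hmY₂ : m ∉ Y₂ := fun h => hmY₁ (mem_insert_of_mem h)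
    rcases Y₂.eq_empty_or_nonempty with rfl | h₂
    -- With two nodes `l < m`, all weight on `m` leaves the single factor `x - l`.
    · refine ⟨fun y => if y = m then 1 else 0, fun y _ => by dsimp only; split_ifs <;> norm_num,
        by simp, ?_⟩
      rintro x ⟨y, hy, hyx⟩
      have hx : l ≤ x := by
        simp only [insert_empty_eq, mem_insert, mem_singleton] at hy
        rcases hy with rfl | rfl <;> linarith
      rw [sum_insert hmY₁, erase_insert hmY₁]
      simp [hlm.ne', hx]
    obtain ⟨c, hc, hcm, hcx⟩ := ih Y₂
      ((ssubset_insert hlY₂).trans (ssubset_insert hmY₁)) h₂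
    have hβ : ∀ y ∈ Y₂, 0 ≤ (m - l) / (m - y) := fun y hy =>
      div_nonneg (by linarith) (by linarith [hlt₂ y hy])
    -- The two largest nodes `l < m` are added to `Y₂` so that the old combination is multiplied by
    -- `(x - l)²`. The weights come from `(m - l)(x - y) + (l - y)(x - m) = (m - y)(x - l)`; the
    -- node `l` gets weight `0`.
    refine ⟨fun y => if y = m then ∑ y ∈ Y₂, c y * ((m - l) / (m - y)) else
        if y = l then 0 else c y * ((l - y) / (m - y)), ?_, ?_, ?_⟩
    · intro y hy
      dsimp only
      split_ifs with h1 h2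
      · exact sum_nonneg fun y hy => mul_nonneg (hc y hy) (hβ y hy)
      · exact le_rfl
      · have hy2 : y ∈ Y₂ := by
          simpa [h1, h2] using hy
        exact mul_nonneg (hc y hy2) (div_nonneg (by linarith [hlt₂ y hy2]) (by linarith [hlt₂ y hy2]))
    · dsimp only
      rw [if_pos rfl]
      have hmem := Y₂.max'_mem h₂
      refine sum_pos' (fun y hy => mul_nonneg (hc y hy) (hβ y hy)) ⟨_, hmem, mul_pos hcm ?_⟩
      exact div_pos (by linarith) (by linarith [hlt₂ _ hmem])
    · rintro x ⟨y, hy, hyx⟩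
      have hx : ∃ y ∈ Y₂, y ≤ x := by
        by_cases hy2 : y ∈ Y₂
        · exact ⟨y, hy2, hyx⟩
        · obtain ⟨z, hz⟩ := h₂
          refine ⟨z, hz, ?_⟩
          have hz' := hlt₂ z hz
          simp only [mem_insert, hy2, or_false] at hy
          rcases hy with rfl | rfl <;> linarith
      have key := mul_nonneg (sq_nonneg (x - l)) (hcx x hx)
      refine key.trans_eq ?_
      rw [sum_insert hmY₁, sum_insert hlY₂, erase_insert hmY₁, prod_insert hlY₂]
      simp only [if_true, hlm.ne, if_false, zero_mul, zero_add]
      rw [sum_mul, mul_sum, ← sum_add_distrib]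
      refine sum_congr rfl fun y hy => ?_
      have hyl := hlt₂ y hy
      have hym : m - y ≠ 0 := by linarith
      have e1 : (insert m (insert l Y₂)).erase y = insert m (insert l (Y₂.erase y)) := by
        rw [erase_insert_of_ne (by linarith), erase_insert_of_ne (by linarith)]
      rw [if_neg (by linarith), if_neg (by linarith), e1, prod_insert, prod_insert,
        ← mul_prod_erase Y₂ _ hy]
      · field_simp
        ring
      · exact fun h => hlY₂ (mem_of_mem_erase h)
      · rw [mem_insert, not_or]
        exact ⟨by linarith, fun h => hmY₂ (mem_of_mem_erase h)⟩

/-! ### From roots to sign changes -/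

lemma cos_two_mul_half_arccos {y : ℝ} (hy : y ∈ Set.Icc (-1 : ℝ) 1) :
    Real.cos (2 * (Real.arccos y / 2)) = y := by
  rw [mul_div_cancel₀ _ two_ne_zero, Real.cos_arccos hy.1 hy.2]

lemma half_arccos_mem {y : ℝ} (hy : y ∈ Set.Ioo (-1 : ℝ) 1) :
    Real.arccos y / 2 ∈ Set.Ioo 0 (Real.pi / 2) := by
  have h0 : 0 < Real.arccos y := Real.arccos_pos.2 hy.2
  have h1 : Real.arccos y < Real.pi := by
    refine lt_of_le_of_ne (Real.arccos_le_pi y) fun h => ?_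
    rw [Real.arccos_eq_pi] at h
    linarith [hy.1]
  exact ⟨by linarith, by linarith⟩

/-- Near `t`, the factor `cos 2s - y` strictly decreases through zero, while `cos s`, the other
linear factors and `R` contribute no sign change. -/
lemma half_arccos_mem_signChanges {N : ℕ} {a : Fin N → ℝ} {Z : Finset ℝ} {R : ℝ[X]}
    (hfac : cosFactor a = (∏ y ∈ Z, (X - C y)) * R) (hR0 : R ≠ 0)
    (hR : ∀ x ∈ Set.Icc (-1 : ℝ) 1, 0 ≤ R.eval x) {y : ℝ} (hyZ : y ∈ Z)
    (hy : y ∈ Set.Ioo (-1 : ℝ) 1) :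
    Real.arccos y / 2 ∈ signChanges a := by
  refine ⟨half_arccos_mem hy, ?_⟩
  have ht := half_arccos_mem hy
  have hcos : Real.cos (2 * (Real.arccos y / 2)) = y :=
    cos_two_mul_half_arccos ⟨hy.1.le, hy.2.le⟩
  set t := Real.arccos y / 2
  let H : ℝ[X] := ∏ z ∈ Z.erase y, (X - C z)
  have hH : H.eval y ≠ 0 := by
    simp only [H, eval_prod, eval_sub, eval_X, eval_C]
    exact prod_ne_zero_iff.2 fun z hz => sub_ne_zero.2 (ne_of_mem_erase hz).symm
  have hval : ∀ s, Real.cos s ≠ 0 → cosPoly a s = Real.cos s * ((Real.cos (2 * s) - y) *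
      H.eval (Real.cos (2 * s)) * R.eval (Real.cos (2 * s))) := by
    intro s hs
    rw [cosPoly_eq a hs, hfac, ← mul_prod_erase Z _ hyZ]
    simp [H]
  have hcont : Continuous fun s : ℝ => Real.cos (2 * s) := by fun_prop
  have h1 : ∀ᶠ s in nhds t, s ∈ Set.Ioo 0 (Real.pi / 2) := isOpen_Ioo.mem_nhds ht
  have h2 : ∀ᶠ s in nhds t, 0 < H.eval y * H.eval (Real.cos (2 * s)) := by
    have : Continuous fun s : ℝ => H.eval y * H.eval (Real.cos (2 * s)) :=
      continuous_const.mul (H.continuous.comp hcont)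
    refine this.continuousAt.eventually_const_lt ?_
    simpa only [hcos] using mul_self_pos.2 hH
  have h3 : ∀ᶠ s in nhds t, Real.cos (2 * s) ≠ y → 0 < R.eval (Real.cos (2 * s)) := by
    have h := eventually_nhdsWithin_iff.1 (eventually_pos_of_nonneg hR0 hR hy)
    have htend := hcont.tendsto t
    rw [hcos] at htend
    exact htend.eventually h
  obtain ⟨ε, hε, hball⟩ := Metric.eventually_nhds_iff.1 (h1.and (h2.and h3))
  refine ⟨ε, hε, fun u hu v hv => ?_⟩
  obtain ⟨hu1, hu2, hu3⟩ := hball (y := u) (by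
    rw [Real.dist_eq, abs_lt]; constructor <;> linarith [hu.1, hu.2])
  obtain ⟨hv1, hv2, hv3⟩ := hball (y := v) (by
    rw [Real.dist_eq, abs_lt]; constructor <;> linarith [hv.1, hv.2])
  have hcu : y < Real.cos (2 * u) := by
    rw [← hcos]
    exact Real.cos_lt_cos_of_nonneg_of_le_pi (by linarith [hu1.1]) (by linarith [ht.2])
      (by linarith [hu.2])
  have hcv : Real.cos (2 * v) < y := by
    rw [← hcos]
    exact Real.cos_lt_cos_of_nonneg_of_le_pi (by linarith [ht.1]) (by linarith [hv1.2])
      (by linarith [hv.1])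
  have pu : 0 < Real.cos u := Real.cos_pos_of_mem_Ioo ⟨by linarith [hu1.1, Real.pi_pos], hu1.2⟩
  have pv : 0 < Real.cos v := Real.cos_pos_of_mem_Ioo ⟨by linarith [hv1.1, Real.pi_pos], hv1.2⟩
  have hRu := hu3 hcu.ne'
  have hRv := hv3 hcv.ne
  have hHH : 0 < H.eval (Real.cos (2 * u)) * H.eval (Real.cos (2 * v)) := by
    have := mul_pos hu2 hv2
    have hsq := mul_self_pos.2 hH
    refine pos_of_mul_pos_right (a := H.eval y * H.eval y) ?_ hsq.le
    linarith [this, mul_mul_mul_comm (H.eval y) (H.eval (Real.cos (2 * u))) (H.eval y)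
      (H.eval (Real.cos (2 * v)))]
  rw [hval u pu.ne', hval v pv.ne']
  have hdiff : (Real.cos (2 * u) - y) * (Real.cos (2 * v) - y) < 0 :=
    mul_neg_of_pos_of_neg (by linarith) (by linarith)
  have hpos := mul_pos (mul_pos (mul_pos pu pv) (mul_pos hRu hRv)) hHH
  have := mul_neg_of_pos_of_neg hpos hdiff
  linarith [this]

/-! ### The lower bound `1 / N` -/

lemma eval_one_div_le_nodeMean {N : ℕ} (hN : 1 ≤ N) {P : ℝ[X]}
    (hP : ∀ x ∈ Set.Icc (-1 : ℝ) 1, 0 ≤ P.eval x) : 1 / (N : ℝ) * P.eval 1 ≤ nodeMean N P := by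
  rw [nodeMean_apply]
  refine mul_le_mul_of_nonneg_left ?_ (by positivity)
  have := single_le_sum (f := fun j => P.eval (node N j)) (fun j _ => hP _ (node_mem N j))
    (mem_range.2 hN)
  simpa only [node_zero] using this

/-- The equality case of `eval_one_div_le_nodeMean`: all discarded terms must be zero. -/
lemma eval_node_eq_zero {N : ℕ} (hN : 1 ≤ N) {P : ℝ[X]}
    (hP : ∀ x ∈ Set.Icc (-1 : ℝ) 1, 0 ≤ P.eval x) (hle : nodeMean N P ≤ 1 / (N : ℝ) * P.eval 1)
    {j : ℕ} (hj : 0 < j) (hjN : j < N) : P.eval (node N j) = 0 := by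
  rw [nodeMean_apply] at hle
  have hle' := le_of_mul_le_mul_left hle (by positivity)
  rw [← add_sum_erase _ _ (mem_range.2 hN), node_zero] at hle'
  have h0 : ∀ i ∈ (range N).erase 0, 0 ≤ P.eval (node N i) := fun i _ => hP _ (node_mem N i)
  have hs : ∑ i ∈ (range N).erase 0, P.eval (node N i) = 0 :=
    le_antisymm (by linarith) (sum_nonneg h0)
  exact (sum_eq_zero_iff_of_nonneg h0).1 hs j (by simp [hj.ne', hjN])

lemma sinPoly_pi_div_two {N : ℕ} (hN : 1 ≤ N) (a : Fin N → ℝ) :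
    sinPoly a (Real.pi / 2) = nodeMean N (cosFactor a) := by
  rw [sinPoly_eq hN a (H := cosFactor a), Real.sin_pi_div_two, one_mul]
  rw [mul_div_cancel₀ _ two_ne_zero, Real.cos_pi]
  simp

/-- If the conjugate sine polynomial is at most `1 / N` at `π / 2` and at all sign changes of the
normalized cosine polynomial, then there are no sign changes. -/
theorem cosFactor_nonneg {N : ℕ} (hN : 1 ≤ N) {a : Fin N → ℝ} (ha : ∑ j, a j = 1)
    (hS : ∀ t ∈ signChanges a ∪ {Real.pi / 2}, sinPoly a t ≤ 1 / (N : ℝ)) :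
    ∀ x ∈ Set.Icc (-1 : ℝ) 1, 0 ≤ (cosFactor a).eval x := by
  have hQ1 : (cosFactor a).eval 1 = 1 := (cosFactor_eval_one a).trans ha
  obtain ⟨Z, R, hZ, hfac, hR⟩ := exists_simple_factor (cosFactor a) (by rw [hQ1]; norm_num)
  rcases Z.eq_empty_or_nonempty with rfl | hne
  · rw [hfac, prod_empty, one_mul]
    exact hR
  exfalso
  have hN0 : (0 : ℝ) < N := by exact_mod_cast hN
  have hR0 : R ≠ 0 := by
    rintro rfl
    rw [hfac] at hQ1
    simp at hQ1
  have hnot : (-1 : ℝ) ∉ Z := fun h => lt_irrefl _ (hZ _ h).1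
  -- The extra node `-1` encodes the test point `π/2`.
  let Y : Finset ℝ := insert (-1) Z
  have hY : Y.Nonempty := insert_nonempty _ _
  have hYmem : ∀ y ∈ Y, y ∈ Set.Ico (-1 : ℝ) 1 := by
    intro y hy
    rcases mem_insert.1 hy with rfl | hy
    · norm_num
    · exact ⟨(hZ y hy).1.le, (hZ y hy).2⟩
  have hG : (X + 1) * cosFactor a = (∏ y ∈ Y, (X - C y)) * R := by
    rw [hfac, prod_insert hnot]
    simp [mul_assoc]
  let p : ℝ → ℝ[X] := fun y => ∏ z ∈ Y.erase y, (X - C z)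
  have hp : ∀ y x, (p y).eval x = ∏ z ∈ Y.erase y, (x - z) := by
    intro y x
    simp [p, eval_prod]
  let L : ℝ → ℝ := fun y => nodeMean N (p y * R)
  have hone : ∀ y ∈ Y, (p y * R).eval 1 = 2 / (1 - y) := by
    intro y hy
    have h := congrArg (eval 1) hG
    rw [← mul_prod_erase Y _ hy, eval_mul, hQ1, mul_assoc, eval_mul] at h
    rw [eq_div_iff (by linarith [(hYmem y hy).2])]
    simp only [eval_add, eval_X, eval_one, eval_sub, eval_C] at h
    change _ = (1 - y) * (p y * R).eval 1 at h
    linarith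
  have hL : ∀ y ∈ Y, L y ≤ 1 / (N : ℝ) * (2 / (1 - y)) ∧
      (-1 < y → L y < 1 / (N : ℝ) * (2 / (1 - y))) := by
    intro y hy
    have hmem := hYmem y hy
    have hcos := cos_two_mul_half_arccos (y := y) ⟨hmem.1, hmem.2.le⟩
    have hT : Real.arccos y / 2 ∈ signChanges a ∪ {Real.pi / 2} := by
      rcases mem_insert.1 hy with rfl | hyZ
      · right
        simp
      · exact Or.inl (half_arccos_mem_signChanges hfac hR0 hR hyZ (hZ y hyZ))
    have hle := hS _ hT
    rw [sinPoly_eq hN a (H := p y * R) (by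
      rw [hG, hcos, ← mul_prod_erase Y _ hy, mul_assoc])] at hle
    change _ * L y ≤ _ at hle
    set s := Real.sin (Real.arccos y / 2)
    have hs2 : 2 * s ^ 2 = 1 - y := by
      rw [← hcos, Real.cos_two_mul]
      have := Real.sin_sq_add_cos_sq (Real.arccos y / 2)
      simp only [s]
      linarith
    have hs : 0 < s := by
      have h0 : 0 < Real.arccos y := Real.arccos_pos.2 hmem.2
      exact Real.sin_pos_of_pos_of_lt_pi (by linarith)
        (by linarith [Real.arccos_le_pi y, Real.pi_pos])
    -- The hypothesis bounds `L y` by `1/(N s)`, whereas the value at `1` over `N` is `1/(N s²)`.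
    -- Since `0 < s ≤ 1` this is weaker, and strictly so unless `y = -1`.
    have hLs : L y ≤ 1 / (N : ℝ) * (1 / s) := by
      rw [mul_one_div, le_div_iff₀ hs]
      linarith
    have hfrac : 2 / (1 - y) = 1 / s * (1 / s) := by
      rw [← hs2]
      field_simp
    rw [hfrac]
    have hNinv : 0 < 1 / (N : ℝ) := by positivity
    have hsinv : 0 < 1 / s := by positivity
    constructor
    · have h1 : 1 ≤ 1 / s := by
        rw [le_div_iff₀ hs]
        nlinarith [hmem.1]
      exact hLs.trans (mul_le_mul_of_nonneg_left (le_mul_of_one_le_left hsinv.le h1) hNinv.le)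
    · intro hy1
      have h1 : 1 < 1 / s := by
        rw [lt_div_iff₀ hs]
        nlinarith
      exact hLs.trans_lt (mul_lt_mul_of_pos_left (lt_mul_of_one_lt_left hsinv h1) hNinv)
  obtain ⟨c, hc, hcm, hcx⟩ := exists_nonneg_combination Y hY
  -- The largest node carries positive weight and differs from `-1`, which makes the summed
  -- inequality strict.
  have hmax : -1 < Y.max' hY := by
    obtain ⟨z, hz⟩ := hne
    exact (hZ z hz).1.trans_le (le_max' _ _ (mem_insert_of_mem hz))
  have hlt : ∑ y ∈ Y, c y * L y < ∑ y ∈ Y, c y * (1 / (N : ℝ) * (2 / (1 - y))) := by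
    refine sum_lt_sum (fun y hy => mul_le_mul_of_nonneg_left (hL y hy).1 (hc y hy))
      ⟨_, Y.max'_mem hY, mul_lt_mul_of_pos_left ((hL _ (Y.max'_mem hY)).2 hmax) hcm⟩
  let P : ℝ[X] := ∑ y ∈ Y, c y • (p y * R)
  have hPeval : ∀ x, P.eval x = (∑ y ∈ Y, c y * ∏ z ∈ Y.erase y, (x - z)) * R.eval x := by
    intro x
    simp only [P, eval_finsetSum, eval_smul, eval_mul, hp, smul_eq_mul, sum_mul, mul_assoc]
  have hPnn : ∀ x ∈ Set.Icc (-1 : ℝ) 1, 0 ≤ P.eval x := by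
    intro x hx
    rw [hPeval]
    exact mul_nonneg (hcx x ⟨-1, mem_insert_self _ _, hx.1⟩) (hR x hx)
  have hge := eval_one_div_le_nodeMean hN hPnn
  have e1 : nodeMean N P = ∑ y ∈ Y, c y * L y := by
    simp only [P, map_sum, map_smul, smul_eq_mul, L]
  have e2 : 1 / (N : ℝ) * P.eval 1 = ∑ y ∈ Y, c y * (1 / (N : ℝ) * (2 / (1 - y))) := by
    simp only [P, eval_finsetSum, eval_smul, smul_eq_mul, mul_sum]
    refine sum_congr rfl fun y hy => ?_
    rw [hone y hy]
    ring
  rw [e1, e2] at hge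
  exact absurd hlt (not_lt.2 hge)

/-! ### Existence of the maximum -/

lemma continuous_cosPoly {N : ℕ} (a : Fin N → ℝ) : Continuous (cosPoly a) := by
  unfold cosPoly
  fun_prop

lemma IsSignChange.eq_zero {f : ℝ → ℝ} (hf : Continuous f) {t : ℝ} (h : IsSignChange f t) :
    f t = 0 := by
  obtain ⟨ε, hε, h⟩ := h
  by_contra hne
  have hev : ∀ᶠ s in nhds t, 0 < f t * f s :=
    (continuous_const.mul hf).continuousAt.eventually_const_lt (mul_self_pos.2 hne)
  obtain ⟨δ, hδ, hball⟩ := Metric.eventually_nhds_iff.1 hev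
  have hm : 0 < min ε δ := lt_min hε hδ
  have h1 := min_le_left ε δ
  have h2 := min_le_right ε δ
  have hu := hball (y := t - min ε δ / 2) (by
    rw [Real.dist_eq, abs_lt]; constructor <;> linarith)
  have hv := hball (y := t + min ε δ / 2) (by
    rw [Real.dist_eq, abs_lt]; constructor <;> linarith)
  have huv := h (t - min ε δ / 2) ⟨by linarith, by linarith⟩ (t + min ε δ / 2)
    ⟨by linarith, by linarith⟩
  nlinarith [mul_pos hu hv, mul_self_pos.2 hne]

/-- Sign changes map injectively under `t ↦ cos 2t` to roots of the nonzero polynomial `cosFactor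
a`. -/
lemma finite_signChanges {N : ℕ} {a : Fin N → ℝ} (ha : ∑ j, a j = 1) : (signChanges a).Finite := by
  have h0 : cosFactor a ≠ 0 := by
    intro h
    have h1 := cosFactor_eval_one a
    rw [h, ha, eval_zero] at h1
    exact zero_ne_one h1
  have himg : ((fun t : ℝ => Real.cos (2 * t)) '' signChanges a).Finite := by
    refine (cosFactor a).roots.toFinset.finite_toSet.subset ?_
    rintro _ ⟨t, ⟨ht, hsc⟩, rfl⟩
    have hcos : Real.cos t ≠ 0 :=
      (Real.cos_pos_of_mem_Ioo ⟨by linarith [ht.1, Real.pi_pos], ht.2⟩).ne'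
    have hz := hsc.eq_zero (continuous_cosPoly a)
    rw [cosPoly_eq a hcos, mul_eq_zero, or_iff_right hcos] at hz
    simpa [h0] using hz
  refine himg.of_finite_image fun s hs t ht hst => ?_
  have hmem : ∀ u ∈ signChanges a, 2 * u ∈ Set.Icc 0 Real.pi := fun u hu =>
    ⟨by linarith [hu.1.1], by linarith [hu.1.2]⟩
  have := Real.injOn_cos (hmem s hs) (hmem t ht) hst
  linarith

lemma isGreatest_objective {N : ℕ} {a : Fin N → ℝ} (ha : ∑ j, a j = 1) :
    IsGreatest (testValues a) (objective a) := by
  have hfin : (testValues a).Finite :=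
    ((finite_signChanges ha).union (Set.finite_singleton _)).image _
  have hne : (testValues a).Nonempty := ⟨_, Real.pi / 2, Or.inr rfl, rfl⟩
  exact ⟨hne.csSup_mem hfin, fun x hx => le_csSup hfin.bddAbove hx⟩

lemma sinPoly_le_of_objective_le {N : ℕ} {a : Fin N → ℝ} (ha : ∑ j, a j = 1) {c : ℝ}
    (h : objective a ≤ c) : ∀ t ∈ signChanges a ∪ {Real.pi / 2}, sinPoly a t ≤ c :=
  fun t ht => ((isGreatest_objective ha).2 ⟨t, ht, rfl⟩).trans h

lemma one_div_le_objective {N : ℕ} (hN : 1 ≤ N) {a : Fin N → ℝ} (ha : ∑ j, a j = 1) :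
    1 / (N : ℝ) ≤ objective a := by
  by_contra! hlt
  have hS := sinPoly_le_of_objective_le ha hlt.le
  have h := eval_one_div_le_nodeMean hN (cosFactor_nonneg hN ha hS)
  rw [cosFactor_eval_one, ha, mul_one, ← sinPoly_pi_div_two hN] at h
  have := (isGreatest_objective ha).2 ⟨Real.pi / 2, Or.inr rfl, rfl⟩
  linarith

/-! ### Uniqueness of the minimizer -/

lemma node_angle_mem {N j : ℕ} (hN : 1 ≤ N) (hj : 2 * j ≤ N) :
    2 * Real.pi * j / N ∈ Set.Icc 0 Real.pi := by
  have hN0 : (0 : ℝ) < N := by exact_mod_cast hN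
  have hj' : (2 * j : ℝ) ≤ N := by exact_mod_cast hj
  refine ⟨by have := Real.pi_pos; positivity, ?_⟩
  rw [div_le_iff₀ hN0]
  nlinarith [Real.pi_pos]

lemma node_injOn {N : ℕ} (hN : 1 ≤ N) {i j : ℕ} (hi : 2 * i ≤ N) (hj : 2 * j ≤ N)
    (h : node N i = node N j) : i = j := by
  have hN0 : (N : ℝ) ≠ 0 := by positivity
  have := Real.injOn_cos (node_angle_mem hN hi) (node_angle_mem hN hj) h
  have hpi := Real.pi_ne_zero
  field_simp at this
  exact_mod_cast this

lemma node_mem_Ioo {N j : ℕ} (hj : 0 < j) (hjN : 2 * j < N) :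
    node N j ∈ Set.Ioo (-1 : ℝ) 1 := by
  have hN0 : (0 : ℝ) < N := by exact_mod_cast (by omega : 0 < N)
  have hj0 : (0 : ℝ) < j := by exact_mod_cast hj
  have hjN' : (2 * j : ℝ) < N := by exact_mod_cast hjN
  have h0 : 0 < 2 * Real.pi * j / N := by have := Real.pi_pos; positivity
  have h1 : 2 * Real.pi * j / N < Real.pi := by
    rw [div_lt_iff₀ hN0]
    nlinarith [Real.pi_pos]
  constructor
  · rw [← Real.cos_pi]
    exact Real.cos_lt_cos_of_nonneg_of_le_pi h0.le le_rfl h1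
  · rw [← Real.cos_zero]
    exact Real.cos_lt_cos_of_nonneg_of_le_pi le_rfl h1.le h0

lemma derivative_eval_eq_zero {P : ℝ[X]} (hP : ∀ x ∈ Set.Icc (-1 : ℝ) 1, 0 ≤ P.eval x)
    {y : ℝ} (hy : y ∈ Set.Ioo (-1 : ℝ) 1) (h0 : P.eval y = 0) : P.derivative.eval y = 0 := by
  have hmin : IsLocalMin (fun x => P.eval x) y := by
    filter_upwards [isOpen_Ioo.mem_nhds hy] with x hx
    rw [h0]
    exact hP x ⟨hx.1.le, hx.2.le⟩
  rw [← P.deriv]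
  exact hmin.deriv_eq_zero

/-- The multiplicity of `cos (2πj/N)`, `2j ≤ N`, as a root of `T_N - 1`. -/
def nodeMult (N j : ℕ) : ℕ := if j = 0 ∨ 2 * j = N then 1 else 2

lemma sum_nodeMult {N : ℕ} (hN : 1 ≤ N) : ∑ j ∈ range (N / 2 + 1), nodeMult N j = N := by
  rw [sum_range_succ']
  have h0 : nodeMult N 0 = 1 := by simp [nodeMult]
  have h2 : ∀ j, 2 * (j + 1) < N → nodeMult N (j + 1) = 2 := by
    intro j hj
    rw [nodeMult, if_neg (by omega)]
  rcases Nat.even_or_odd' N with ⟨m, rfl | rfl⟩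
  · obtain ⟨k, rfl⟩ : ∃ k, m = k + 1 := ⟨m - 1, by omega⟩
    rw [show 2 * (k + 1) / 2 = k + 1 by omega, sum_range_succ, h0,
      sum_congr rfl fun j hj => h2 j (by have := mem_range.1 hj; omega)]
    simp [nodeMult]
    ring
  · rw [show (2 * m + 1) / 2 = m by omega, h0,
      sum_congr rfl fun j hj => h2 j (by have := mem_range.1 hj; omega)]
    simp
    ring

/-- Polynomials of degree less than `N` that are nonnegative on `[-1, 1]` and vanish at the nodes
`cos (2πj/N)`, `0 < j < N`, are determined by their value at `1`. -/
lemma eq_of_nonneg_of_eval_node {N : ℕ} (hN : 1 ≤ N) {P Q : ℝ[X]} (hPd : P.degree < N)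
    (hQd : Q.degree < N) (hP : ∀ x ∈ Set.Icc (-1 : ℝ) 1, 0 ≤ P.eval x)
    (hQ : ∀ x ∈ Set.Icc (-1 : ℝ) 1, 0 ≤ Q.eval x) (h1 : P.eval 1 = Q.eval 1)
    (hPn : ∀ j, 0 < j → j < N → P.eval (node N j) = 0)
    (hQn : ∀ j, 0 < j → j < N → Q.eval (node N j) = 0) : P = Q := by
  by_contra hne
  have hD : P - Q ≠ 0 := sub_ne_zero.2 hne
  have hdvd : ∏ j ∈ range (N / 2 + 1), (X - C (node N j)) ^ nodeMult N j ∣ P - Q := by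
    refine prod_dvd_of_coprime ?_ ?_
    · intro i hi j hj hij
      rw [mem_coe, mem_range] at hi hj
      refine IsCoprime.pow (isCoprime_X_sub_C_of_isUnit_sub (sub_ne_zero.2 fun h => hij ?_).isUnit)
      exact node_injOn hN (by omega) (by omega) h
    · intro j hj
      rw [mem_range] at hj
      rw [nodeMult]
      split_ifs with hc
      · rw [pow_one, dvd_iff_isRoot, IsRoot, eval_sub, sub_eq_zero]
        rcases Nat.eq_zero_or_pos j with rfl | hpos
        · rw [node_zero, h1]
        · rw [hPn j hpos (by omega), hQn j hpos (by omega)]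
      · have hj0 : 0 < j := by omega
        have hmem := node_mem_Ioo hj0 (by omega : 2 * j < N)
        have p0 := hPn j hj0 (by omega)
        have q0 := hQn j hj0 (by omega)
        -- An interior zero of a polynomial nonnegative on `[-1, 1]` is a minimum, so both
        -- derivatives vanish there too.
        rw [← le_rootMultiplicity_iff hD]
        refine (one_lt_rootMultiplicity_iff_isRoot hD).2 ⟨?_, ?_⟩
        · rw [IsRoot, eval_sub, p0, q0, sub_zero]
        · rw [IsRoot, derivative_sub, eval_sub, derivative_eval_eq_zero hP hmem p0,
            derivative_eval_eq_zero hQ hmem q0, sub_zero]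
  have hdeg := degree_le_of_dvd hdvd hD
  rw [degree_prod] at hdeg
  simp only [degree_pow, degree_X_sub_C, nsmul_eq_mul, mul_one] at hdeg
  rw [← Nat.cast_sum, sum_nodeMult hN] at hdeg
  have hlt := (degree_sub_le P Q).trans_lt (max_lt hPd hQd)
  exact absurd hdeg (not_le.2 hlt)

lemma eq_of_objective_le {N : ℕ} (hN : 1 ≤ N) {a b : Fin N → ℝ} (ha : ∑ j, a j = 1)
    (hb : ∑ j, b j = 1) (hOa : objective a ≤ 1 / (N : ℝ)) (hOb : objective b ≤ 1 / (N : ℝ)) :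
    a = b := by
  have hnn : ∀ {c : Fin N → ℝ}, ∑ j, c j = 1 → objective c ≤ 1 / (N : ℝ) →
      (∀ x ∈ Set.Icc (-1 : ℝ) 1, 0 ≤ (cosFactor c).eval x) ∧
      ∀ j, 0 < j → j < N → (cosFactor c).eval (node N j) = 0 := by
    intro c hc hO
    have hS := sinPoly_le_of_objective_le hc hO
    have h := cosFactor_nonneg hN hc hS
    refine ⟨h, fun j hj hjN => eval_node_eq_zero hN h ?_ hj hjN⟩
    rw [← sinPoly_pi_div_two hN, cosFactor_eval_one, hc, mul_one]
    exact hS _ (Or.inr rfl)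
  apply cosFactor_injective
  exact eq_of_nonneg_of_eval_node hN (degree_cosFactor_lt a) (degree_cosFactor_lt b)
    (hnn ha hOa).1 (hnn hb hOb).1 (by rw [cosFactor_eval_one, cosFactor_eval_one, ha, hb])
    (hnn ha hOa).2 (hnn hb hOb).2

/-! ### The optimal vector and Fejér identities -/

/-- Raising `N` by one adds `2` to each old weight and appends a weight `1`. This drives the
inductions below. -/
lemma sum_fejer_succ (f : ℕ → ℝ) (N : ℕ) :
    ∑ j ∈ range (N + 1), (2 * (((N + 1 : ℕ) : ℝ) - ((j : ℝ) + 1)) + 1) * f j =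
      ∑ j ∈ range N, (2 * ((N : ℝ) - ((j : ℝ) + 1)) + 1) * f j + 2 * ∑ j ∈ range N, f j + f N := by
  rw [sum_range_succ, mul_sum, ← sum_add_distrib]
  congr 1
  · refine sum_congr rfl fun j _ => ?_
    push_cast
    ring
  · push_cast
    ring

lemma sum_optCoeff_mul (N : ℕ) (f : ℕ → ℝ) :
    ∑ j : Fin N, optCoeff N j * f j =
      (∑ j ∈ range N, (2 * ((N : ℝ) - ((j : ℝ) + 1)) + 1) * f j) / (N : ℝ) ^ 2 := by
  rw [← Fin.sum_univ_eq_sum_range (fun j => (2 * ((N : ℝ) - ((j : ℝ) + 1)) + 1) * f j), sum_div]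
  refine sum_congr rfl fun j _ => ?_
  rw [optCoeff]
  ring

lemma sum_optCoeff {N : ℕ} (hN : 1 ≤ N) : ∑ j, optCoeff N j = 1 := by
  have h := sum_optCoeff_mul N fun _ => 1
  simp only [mul_one] at h
  have hs : ∀ n : ℕ, ∑ j ∈ range n, (2 * ((n : ℝ) - ((j : ℝ) + 1)) + 1) = (n : ℝ) ^ 2 := by
    intro n
    induction n with
    | zero => simp
    | succ n ih =>
      have := sum_fejer_succ (fun _ => 1) n
      simp only [mul_one] at this
      rw [this, ih]
      simp
      ring
  have hN0 : (N : ℝ) ≠ 0 := by positivity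
  rw [h, hs, div_self (pow_ne_zero 2 hN0)]

lemma sinPoly_optCoeff {N : ℕ} (hN : 1 ≤ N) :
    sinPoly (optCoeff N) (Real.pi / 2) = 1 / (N : ℝ) := by
  have hsin : ∀ j : ℕ, Real.sin ((2 * ((j : ℝ) + 1) - 1) * (Real.pi / 2)) = (-1) ^ j := by
    intro j
    rw [show (2 * ((j : ℝ) + 1) - 1) * (Real.pi / 2) = Real.pi / 2 + j * Real.pi by ring,
      Real.sin_add_nat_mul_pi, Real.sin_pi_div_two, mul_one]
  have halt : ∀ n : ℕ, 2 * ∑ j ∈ range n, (-1 : ℝ) ^ j + (-1) ^ n = 1 := by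
    intro n
    induction n with
    | zero => simp
    | succ n ih =>
      rw [sum_range_succ, pow_succ]
      linarith
  have hs : ∀ n : ℕ,
      ∑ j ∈ range n, (2 * ((n : ℝ) - ((j : ℝ) + 1)) + 1) * (-1 : ℝ) ^ j = n := by
    intro n
    induction n with
    | zero => simp
    | succ n ih =>
      rw [sum_fejer_succ, ih, add_assoc, halt]
      push_cast
      ring
  have hN0 : (N : ℝ) ≠ 0 := by positivity
  rw [sinPoly, sum_optCoeff_mul N fun j => Real.sin ((2 * ((j : ℝ) + 1) - 1) * (Real.pi / 2))]
  simp only [hsin]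
  rw [hs]
  field_simp

lemma cosPoly_optCoeff_eq_sum (N : ℕ) (t : ℝ) :
    cosPoly (optCoeff N) t =
      (∑ j ∈ range N, (2 * ((N : ℝ) - ((j : ℝ) + 1)) + 1) *
        Real.cos ((2 * ((j : ℝ) + 1) - 1) * t)) / (N : ℝ) ^ 2 :=
  sum_optCoeff_mul N fun j => Real.cos ((2 * ((j : ℝ) + 1) - 1) * t)

lemma two_mul_sin_mul_sum_cos (n : ℕ) (t : ℝ) :
    2 * (Real.sin t * ∑ j ∈ range n, Real.cos ((2 * ((j : ℝ) + 1) - 1) * t)) =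
      Real.sin (2 * n * t) := by
  induction n with
  | zero => simp
  | succ n ih =>
    rw [sum_range_succ, mul_add, mul_add, ih,
      show 2 * ((n + 1 : ℕ) : ℝ) * t = (2 * ((n : ℝ) + 1) - 1) * t + t by push_cast; ring,
      show 2 * (n : ℝ) * t = (2 * ((n : ℝ) + 1) - 1) * t - t by ring, Real.sin_add, Real.sin_sub]
    ring

lemma sin_sq_mul_fejer_sum (n : ℕ) (t : ℝ) :
    Real.sin t ^ 2 * ∑ j ∈ range n, (2 * ((n : ℝ) - ((j : ℝ) + 1)) + 1) *
        Real.cos ((2 * ((j : ℝ) + 1) - 1) * t) = Real.sin (n * t) ^ 2 * Real.cos t := by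
  induction n with
  | zero => simp
  | succ n ih =>
    have h := two_mul_sin_mul_sum_cos n t
    rw [sum_fejer_succ (fun j => Real.cos ((2 * ((j : ℝ) + 1) - 1) * t)), mul_add, mul_add, ih,
      show (2 * ((n : ℝ) + 1) - 1) * t = 2 * (n * t) + t by ring,
      show ((n + 1 : ℕ) : ℝ) * t = n * t + t by push_cast; ring]
    rw [show 2 * (n : ℝ) * t = 2 * (n * t) by ring, Real.sin_two_mul] at h
    rw [Real.cos_add, Real.sin_add, Real.cos_two_mul, Real.sin_two_mul]
    have h1 := Real.sin_sq_add_cos_sq t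
    have h2 := Real.sin_sq_add_cos_sq (n * t)
    set S := Real.sin (n * t)
    set K := Real.cos (n * t)
    set s := Real.sin t
    set c := Real.cos t
    linear_combination s * h - (2 * S * K * s + S ^ 2 * c) * h1 + (s ^ 2 * c) * h2

lemma cosPoly_optCoeff_eq_fejer {N : ℕ} (hN : 1 ≤ N) {t : ℝ} (ht : Real.sin t ≠ 0) :
    cosPoly (optCoeff N) t =
      (Real.sin ((N : ℝ) * t) / ((N : ℝ) * Real.sin t)) ^ 2 * Real.cos t := by
  have hN0 : (N : ℝ) ≠ 0 := by positivity
  have h := sin_sq_mul_fejer_sum N t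
  rw [cosPoly_optCoeff_eq_sum, div_pow, div_mul_eq_mul_div, ← h, mul_pow, mul_comm ((N : ℝ) ^ 2),
    mul_div_mul_left _ _ (pow_ne_zero 2 ht)]

lemma cos_mul_sum_cos (n : ℕ) (t : ℝ) :
    Real.cos t * (1 + 2 * ∑ j ∈ Icc 2 (n + 1), Real.cos (2 * ((j : ℝ) - 1) * t)) =
      2 * ∑ j ∈ range n, Real.cos ((2 * ((j : ℝ) + 1) - 1) * t) +
        Real.cos ((2 * ((n : ℝ) + 1) - 1) * t) := by
  induction n with
  | zero => simp; norm_num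
  | succ n ih =>
    rw [sum_Icc_succ_top (by omega), sum_range_succ]
    have h : 2 * (Real.cos t * Real.cos (2 * (((n + 1 + 1 : ℕ) : ℝ) - 1) * t)) =
        Real.cos ((2 * ((n : ℝ) + 1) - 1) * t) +
          Real.cos ((2 * (((n + 1 : ℕ) : ℝ) + 1) - 1) * t) := by
      rw [show (2 * ((n : ℝ) + 1) - 1) * t = 2 * (((n + 1 + 1 : ℕ) : ℝ) - 1) * t - t by
          push_cast; ring,
        show (2 * (((n + 1 : ℕ) : ℝ) + 1) - 1) * t = 2 * (((n + 1 + 1 : ℕ) : ℝ) - 1) * t + t by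
          push_cast; ring, Real.cos_add, Real.cos_sub]
      ring
    linear_combination ih + h

/-- By induction: the increments of the two sides in `n` are the two sides of `cos_mul_sum_cos`. -/
lemma cos_mul_fejer_sum (n : ℕ) (t : ℝ) :
    Real.cos t * ((n : ℝ) + 2 * ∑ j ∈ Icc 2 n, ((n : ℝ) - (j : ℝ) + 1) *
        Real.cos (2 * ((j : ℝ) - 1) * t)) =
      ∑ j ∈ range n, (2 * ((n : ℝ) - ((j : ℝ) + 1)) + 1) *
        Real.cos ((2 * ((j : ℝ) + 1) - 1) * t) := by
  induction n with
  | zero => simp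
  | succ n ih =>
    rw [sum_fejer_succ (fun j => Real.cos ((2 * ((j : ℝ) + 1) - 1) * t)), ← ih, add_assoc,
      ← cos_mul_sum_cos]
    have h : ∑ j ∈ Icc 2 (n + 1), (((n + 1 : ℕ) : ℝ) - (j : ℝ) + 1) *
        Real.cos (2 * ((j : ℝ) - 1) * t) = ∑ j ∈ Icc 2 n, ((n : ℝ) - (j : ℝ) + 1) *
        Real.cos (2 * ((j : ℝ) - 1) * t) + ∑ j ∈ Icc 2 (n + 1), Real.cos (2 * ((j : ℝ) - 1) * t) := by
      -- The added term `j = n + 1` has coefficient `n - (n + 1) + 1 = 0`.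
      have hz : ∑ j ∈ Icc 2 n, ((n : ℝ) - (j : ℝ) + 1) * Real.cos (2 * ((j : ℝ) - 1) * t) =
          ∑ j ∈ Icc 2 (n + 1), ((n : ℝ) - (j : ℝ) + 1) * Real.cos (2 * ((j : ℝ) - 1) * t) := by
        rcases Nat.eq_zero_or_pos n with rfl | hn
        · simp
        · rw [sum_Icc_succ_top (by omega)]
          push_cast
          ring
      rw [hz, ← sum_add_distrib]
      refine sum_congr rfl fun j _ => ?_
      push_cast
      ring
    rw [h]
    push_cast
    ring

lemma cosPoly_optCoeff_eq_expansion {N : ℕ} (hN : 1 ≤ N) (t : ℝ) :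
    cosPoly (optCoeff N) t =
      Real.cos t * (1 / (N : ℝ) + 2 * ∑ j ∈ Icc 2 N,
        ((N : ℝ) - (j : ℝ) + 1) / (N : ℝ) ^ 2 * Real.cos (2 * ((j : ℝ) - 1) * t)) := by
  have hN0 : (N : ℝ) ≠ 0 := by positivity
  rw [cosPoly_optCoeff_eq_sum, ← cos_mul_fejer_sum]
  have h : ∑ j ∈ Icc 2 N, ((N : ℝ) - (j : ℝ) + 1) / (N : ℝ) ^ 2 *
      Real.cos (2 * ((j : ℝ) - 1) * t) = (∑ j ∈ Icc 2 N, ((N : ℝ) - (j : ℝ) + 1) *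
      Real.cos (2 * ((j : ℝ) - 1) * t)) / (N : ℝ) ^ 2 := by
    rw [sum_div]
    exact sum_congr rfl fun j _ => by ring
  rw [h]
  generalize ∑ j ∈ Icc 2 N, ((N : ℝ) - (j : ℝ) + 1) * Real.cos (2 * ((j : ℝ) - 1) * t) = A
  field_simp

lemma signChanges_optCoeff {N : ℕ} (hN : 1 ≤ N) : signChanges (optCoeff N) = ∅ := by
  rw [Set.eq_empty_iff_forall_notMem]
  rintro t ⟨ht, ε, hε, h⟩
  have hnn : ∀ s ∈ Set.Ioo 0 (Real.pi / 2), 0 ≤ cosPoly (optCoeff N) s := by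
    intro s hs
    have hsin : 0 < Real.sin s := Real.sin_pos_of_pos_of_lt_pi hs.1 (by linarith [hs.2, hs.1])
    rw [cosPoly_optCoeff_eq_fejer hN hsin.ne']
    exact mul_nonneg (sq_nonneg _)
      (Real.cos_nonneg_of_mem_Icc ⟨by linarith [hs.1, hs.2], hs.2.le⟩)
  obtain ⟨x, hx1, hx2⟩ := exists_between (max_lt ht.1 (sub_lt_self t hε))
  obtain ⟨y, hy1, hy2⟩ := exists_between (lt_min ht.2 (lt_add_of_pos_right t hε))
  rw [max_lt_iff] at hx1
  rw [lt_min_iff] at hy2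
  have hneg := h x ⟨hx1.2, hx2⟩ y ⟨hy1, hy2.2⟩
  have hpos := mul_nonneg (hnn x ⟨hx1.1, hx2.trans ht.2⟩) (hnn y ⟨ht.1.trans hy1, hy2.1⟩)
  exact absurd hneg (not_lt.2 hpos)

lemma objective_optCoeff {N : ℕ} (hN : 1 ≤ N) : objective (optCoeff N) = 1 / (N : ℝ) := by
  rw [objective, testValues, signChanges_optCoeff hN, Set.empty_union, Set.image_singleton,
    csSup_singleton, sinPoly_optCoeff hN]

end CycleStab

theorem corollary1 (N : ℕ) (hN : 1 ≤ N) :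
    -- the inner maximum exists for every normalized pair
    (∀ a ∈ CycleStab.normalized N,
      IsGreatest (CycleStab.testValues a) (CycleStab.objective a)) ∧
    -- the minimum of the maxima exists and equals `1 / N`
    IsLeast (CycleStab.objective '' CycleStab.normalized N) (1 / (N : ℝ)) ∧
    -- the optimal coefficient vector is unique and given by `optCoeff`
    (∀ a : Fin N → ℝ,
      (a ∈ CycleStab.normalized N ∧ IsMinOn CycleStab.objective (CycleStab.normalized N) a) ↔
        a = CycleStab.optCoeff N) ∧
    -- closed form of the optimal cosine polynomial
    (∀ t : ℝ, Real.sin t ≠ 0 →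
      CycleStab.cosPoly (CycleStab.optCoeff N) t =
        (Real.sin ((N : ℝ) * t) / ((N : ℝ) * Real.sin t)) ^ 2 * Real.cos t) ∧
    -- Fejér expansion of the optimal cosine polynomial
    (∀ t : ℝ,
      CycleStab.cosPoly (CycleStab.optCoeff N) t =
        Real.cos t * (1 / (N : ℝ) + 2 * ∑ j ∈ Finset.Icc 2 N,
          ((N : ℝ) - (j : ℝ) + 1) / (N : ℝ) ^ 2 * Real.cos (2 * ((j : ℝ) - 1) * t))) := by
  have hmem : CycleStab.optCoeff N ∈ CycleStab.normalized N := CycleStab.sum_optCoeff hN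
  have hopt := CycleStab.objective_optCoeff hN
  refine ⟨fun a ha => CycleStab.isGreatest_objective ha, ⟨⟨_, hmem, hopt⟩, ?_⟩, fun a => ⟨?_, ?_⟩,
    fun t ht => CycleStab.cosPoly_optCoeff_eq_fejer hN ht,
    fun t => CycleStab.cosPoly_optCoeff_eq_expansion hN t⟩
  · rintro _ ⟨a, ha, rfl⟩
    exact CycleStab.one_div_le_objective hN ha
  · rintro ⟨ha, hmin⟩
    have hle : CycleStab.objective a ≤ CycleStab.objective (CycleStab.optCoeff N) := hmin hmem
    exact CycleStab.eq_of_objective_le hN ha hmem (hle.trans_eq hopt) hopt.le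
  · rintro rfl
    refine ⟨hmem, fun b hb => ?_⟩
    change CycleStab.objective (CycleStab.optCoeff N) ≤ CycleStab.objective b
    rw [hopt]
    exact CycleStab.one_div_le_objective hN hb
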